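/- Let $\mathscr L$ be a one-sorted first-order language without relation symbols, containing symbols $*,{}^{-1},e$. A *group-based algebra* is an $\mathscr L$-structure which is a group under $*,{}^{-1},e$ and in which $F(e,\dots,e)=e$ for every function symbol $F$ of positive arity. Let $T$ be a first-order theory in $\mathscr L$ all of whose models are group-based algebras, and let $A$ be a model of $T$. *Definitions.* A *quasi-algebraic* formula is one of the form $\forall\bar y\,(\bigwedge\Phi\Rightarrow\psi)$, with $\Phi$ a finite set of atomic formulas and $\psi$ atomic. Let $T_W$ be the set of quasi-algebraic consequences of $T$, and $T_V$ the set of its consequences of the form $\forall\bar x\,\psi$ with $\psi$ atomic. An *$A$-algebra* is a homomorphism $f:A\to B$ of $\mathscr L$-structures (morphisms of $A$-algebras are the homomorphisms compatible with the structure maps). It is *reduced* if $B\models T_W$, and *finitely generated* if $B$ is generated by $f(A)$ together with finitely many elements. - $A$ is *geometrically closed* if for every homomorphism $f:A\to B$ into a model $B$ of $T$, every quasi-algebraic sentence with parameters in $A$ that is true in $A$ is true in $B$ (the parameters being interpreted through $f$). - An *ideal* of a group-based algebra $P$ is a normal subgroup $I$ such that $F(\bar a)\in I$ and $F(\bar a)^{-1}*F(\bar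 b)^{-1}*F(\bar a*\bar b)\in I$ for every function symbol $F$ of positive arity $n$, all $\bar a\in I^n$ and all $\bar b\in P^n$. It is *radical* if $P/I\models T_W$. - $A[X_1,\dots,X_n]$ denotes the $A$-algebra freely generated by $X_1,\dots,X_n$ in the variety $\mathrm{Mod}(T_V)$. The model $A$ is *radically noetherian* if for every $n\ge 0$ every radical ideal of $A[X_1,\dots,X_n]$ is finitely generated as an ideal. - An *affine algebraic variety* over $A$ is a subset $V\subseteq A^n$ ($n\ge 0$) of the form $V=\pi(A)$, the set of points of $A^n$ satisfying a finite set $\pi(\bar x)$ of atomic formulas with parameters in $A$. Let $\mathrm{Th}_W(A|A)$ be the set of quasi-algebraic sentences with parameters in $A$ that are true in $A$. A *morphism* from $V=\pi_1(A)\subseteq A^n$ to $W=\pi_2(A)\subseteq A^m$ is a map $f:V\to W$ for which there is a finite conjunction $\phi(\bar x,\bar y)$ of atomic formulas with parameters in $A$ such that, modulo $\mathrm{Th}_W(A|A)$: $\phi(\bar x,\bar y)\wedge\phi(\bar x,\bar y')$ implies $\bar y=\bar y'$; $\bigwedge\pi_1(\bar x)$ is equivalent to $\exists\bar y\,\phi(\bar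 x,\bar y)$; $\phi(\bar x,\bar y)$ implies $\bigwedge\pi_2(\bar y)$; and such that for all $(\bar b,\bar c)\in V\times W$, $f(\bar b)=\bar c$ if and only if $A\models\phi(\bar b,\bar c)$. These form a category $\mathrm{Aff}_A$. - The *coordinate algebra* $A[V]$ of $V\subseteq A^n$ is the quotient of the algebra of terms with parameters in $A$ and variables $x_1,\dots,x_n$ in which two terms $t,s$ are identified if and only if the equation $t=s$ holds at all points of $V$. A morphism $f:V\to W$ is given on $V$ by a tuple of terms $\bar t(\bar x)$ with parameters in $A$, and $A[f]:A[W]\to A[V]$ is the morphism of $A$-algebras sending the class of $y_j$ to the class of $t_j(\bar x)$. **Theorem.** If $A$ is radically noetherian and geometrically closed, then $V\mapsto A[V]$, $f\mapsto A[f]$ is a duality (a contravariant equivalence of categories) between the category $\mathrm{Aff}_A$ of affine algebraic varieties over $A$ and the category of finitely generated reduced $A$-algebras. -/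

import Mathlib

open FirstOrder

universe u w

namespace GeomAlg

open FirstOrder.Language
open scoped CategoryTheory

/-! ### Quasi-algebraic and algebraic formulas

All languages are allowed to have function symbols in an arbitrary universe `u`.  Only equational
languages (`L.IsAlgebraic`: no relation symbols) are used, so that the universe of the
relation symbols is irrelevant and is taken to be `0`.

A formula with parameters in a structure `A` is a formula whose free variables are indexed by `A`;
it is evaluated in `A` along `id : A → A` and in an `A`-algebra `f : A → B` along `f`.
An atomic formula with parameters in `A` and in the variables `x₁, …, xₙ` is an atomic
`L.BoundedFormula A n`. -/

/-- A quasi-algebraic formula `∀ y₁ … yₙ, ⋀ Φ → ψ`, with `Φ` a finite family of atomic formulas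
and `ψ` an atomic formula. -/
def IsQuasiAlgebraic {L : FirstOrder.Language.{u, 0}} {α : Type*} (φ : L.Formula α) : Prop :=
  ∃ (n : ℕ) (Φ : List (L.BoundedFormula α n)) (ψ : L.BoundedFormula α n),
    (∀ χ ∈ Φ, χ.IsAtomic) ∧ ψ.IsAtomic ∧ φ = ((Φ.foldr (· ⊓ ·) ⊤).imp ψ).alls

/-- An algebraic sentence `∀ x₁ … xₙ, ψ`, with `ψ` atomic. -/
def IsAlgebraicSentence {L : FirstOrder.Language.{u, 0}} (φ : L.Sentence) : Prop :=
  ∃ (n : ℕ) (ψ : L.BoundedFormula Empty n), ψ.IsAtomic ∧ φ = ψ.alls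

/-- `T_W`, the set of quasi-algebraic consequences of `T`; its models form the quasivariety `𝒲`
generated by the models of `T`. -/
def quasiTheory {L : FirstOrder.Language.{u, 0}} (T : L.Theory) : L.Theory :=
  {φ | IsQuasiAlgebraic φ ∧ T ⊨ᵇ φ}

/-- `T_V`, the set of algebraic consequences of `T`; its models form the variety `𝒱` generated by
the models of `T`. -/
def algTheory {L : FirstOrder.Language.{u, 0}} (T : L.Theory) : L.Theory :=
  {φ | IsAlgebraicSentence φ ∧ T ⊨ᵇ φ}

section Affine

set_option linter.unusedSectionVars false

variable {L : FirstOrder.Language.{u, 0}} {A : Type w} [L.Structure A]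

/-- The expansion `(B, v)` of `B` to a structure with parameters in `A` is a model of the
quasi-algebraic diagram of `A`, i.e. of all quasi-algebraic sentences with parameters in `A` that
hold in `A`. -/
def ModelsQuasiDiagram {B : Type*} [L.Structure B] (v : A → B) : Prop :=
  ∀ φ : L.Formula A, IsQuasiAlgebraic φ → φ.Realize id → φ.Realize v

/-- `A` is geometrically closed in the class of models of `T`: every homomorphism from `A` to a
model of `T` preserves the quasi-algebraic sentences with parameters in `A`. -/
def GeometricallyClosed (T : L.Theory) (A : Type w) [L.Structure A] : Prop :=
  ∀ (B : Type (max u w)) [L.Structure B] [B ⊨ T] (f : A →[L] B), ModelsQuasiDiagram (L := L) f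

/-- The tuple `xs` satisfies all the formulas of `π`, the parameters being interpreted by `v`. -/
def Sat {B : Type*} [L.Structure B] {n : ℕ} (π : Set (L.BoundedFormula A n)) (v : A → B)
    (xs : Fin n → B) : Prop :=
  ∀ φ ∈ π, φ.Realize v xs

/-- A finite set of atomic formulas with parameters in `A` and variables `x₁, …, xₙ`. -/
def IsFiniteAType {n : ℕ} (π : Set (L.BoundedFormula A n)) : Prop :=
  π.Finite ∧ ∀ φ ∈ π, φ.IsAtomic

/-- The set `π(A)` of rational points. -/
def zeros {n : ℕ} (π : Set (L.BoundedFormula A n)) : Set (Fin n → A) :=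
  {a | Sat π id a}

/-- The set of all atomic formulas with parameters in `A` that hold at all points of `V`. -/
def aType (L : FirstOrder.Language.{u, 0}) [L.Structure A] {n : ℕ} (V : Set (Fin n → A)) :
    Set (L.BoundedFormula A n) :=
  {φ | φ.IsAtomic ∧ ∀ a ∈ V, φ.Realize id a}

/-- Evaluation of a term with parameters in `A` at a point of a set `B` over `A`. -/
abbrev eval {B : Type*} [L.Structure B] {n : ℕ} (v : A → B) (b : Fin n → B)
    (t : L.Term (A ⊕ Fin n)) : B :=
  t.realize (Sum.elim v b)

/-- The structure of the algebra of terms. -/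
@[reducible] def termStructure (L : FirstOrder.Language.{u, 0}) [L.IsAlgebraic] (α : Type*) :
    L.Structure (L.Term α) where
  funMap F ts := Term.func F ts
  RelMap r := isEmptyElim r

theorem equal_mem_aType {n : ℕ} {V : Set (Fin n → A)} {t s : L.Term (A ⊕ Fin n)} :
    t.bdEqual s ∈ aType L V ↔ ∀ a ∈ V, eval id a t = eval id a s := by
  constructor
  · intro h a ha
    exact BoundedFormula.realize_bdEqual _ _ |>.1 (h.2 a ha)
  · intro h
    exact ⟨.equal _ _, fun a ha => (BoundedFormula.realize_bdEqual _ _).2 (h a ha)⟩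

/-- Two terms are identified when the equation between them belongs to the `a`-type of `V`. -/
def coordSetoid (L : FirstOrder.Language.{u, 0}) [L.Structure A] {n : ℕ} (V : Set (Fin n → A)) :
    Setoid (L.Term (A ⊕ Fin n)) where
  r t s := t.bdEqual s ∈ aType L V
  iseqv :=
    { refl := fun _ => equal_mem_aType.2 fun _ _ => rfl
      symm := fun h => equal_mem_aType.2 fun a ha => (equal_mem_aType.1 h a ha).symm
      trans := fun h h' => equal_mem_aType.2 fun a ha =>
        (equal_mem_aType.1 h a ha).trans (equal_mem_aType.1 h' a ha) }

instance coordPrestructure [L.IsAlgebraic] {n : ℕ} (V : Set (Fin n → A)) :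
    L.Prestructure (coordSetoid L V) where
  toStructure := termStructure L _
  fun_equiv {k F} x y h := equal_mem_aType.2 fun a ha => by
    change Structure.funMap F (fun i => eval id a (x i)) =
      Structure.funMap F (fun i => eval id a (y i))
    congr 1
    funext i
    exact equal_mem_aType.1 (h i) a ha
  rel_equiv {k r} := isEmptyElim r

/-- The coordinate algebra `A[V]`: the quotient of the algebra of terms with parameters in `A` and
variables `x₁, …, xₙ` by the `a`-type of `V`. -/
abbrev CoordAlg (L : FirstOrder.Language.{u, 0}) [L.Structure A] {n : ℕ} (V : Set (Fin n → A)) :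
    Type (max u w) :=
  Quotient (coordSetoid L V)

namespace CoordAlg

variable {n m : ℕ} {V : Set (Fin n → A)}

theorem mk_eq {t s : L.Term (A ⊕ Fin n)} :
    (Quotient.mk (coordSetoid L V) t) = Quotient.mk (coordSetoid L V) s ↔
      ∀ a ∈ V, eval id a t = eval id a s :=
  Quotient.eq.trans equal_mem_aType

/-- The value of an element of `A[V]` at a point of `V`. -/
def value (a : Fin n → A) (ha : a ∈ V) : CoordAlg L V → A :=
  Quotient.lift (eval id a) fun _ _ h => equal_mem_aType.1 h a ha

theorem ext_value {p q : CoordAlg L V} (h : ∀ a ha, value a ha p = value a ha q) : p = q := by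
  induction p using Quotient.inductionOn
  induction q using Quotient.inductionOn
  exact mk_eq.2 h

theorem funMap_mk [L.IsAlgebraic] {k : ℕ} (F : L.Functions k) (ts : Fin k → L.Term (A ⊕ Fin n)) :
    (Structure.funMap F fun i => Quotient.mk (coordSetoid L V) (ts i)) =
      Quotient.mk (coordSetoid L V) (Term.func F ts) :=
  funMap_quotient_mk' (s := coordSetoid L V) F ts

theorem exists_rep {k : ℕ} (x : Fin k → CoordAlg L V) :
    ∃ ts : Fin k → L.Term (A ⊕ Fin n), x = fun i => Quotient.mk (coordSetoid L V) (ts i) :=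
  ⟨fun i => (x i).out, funext fun i => (Quotient.out_eq (x i)).symm⟩

/-- Evaluation at a point of `V`, as a homomorphism. -/
def valueHom [L.IsAlgebraic] (a : Fin n → A) (ha : a ∈ V) : CoordAlg L V →[L] A where
  toFun := value a ha
  map_fun' F x := by
    obtain ⟨ts, rfl⟩ := exists_rep x
    rw [funMap_mk]
    rfl
  map_rel' r := isEmptyElim r

/-- The structure morphism `A → A[V]`. -/
def ofBase (L : FirstOrder.Language.{u, 0}) [L.Structure A] [L.IsAlgebraic] {n : ℕ} (V : Set (Fin n → A)) :
    A →[L] CoordAlg L V where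
  toFun c := Quotient.mk _ (Term.var (Sum.inl c))
  map_fun' F x := by
    refine Eq.trans ?_ (funMap_mk F fun i => Term.var (Sum.inl (x i))).symm
    exact mk_eq.2 fun a ha => rfl
  map_rel' r := isEmptyElim r

/-- The class of the `i`-th variable. -/
def coord (L : FirstOrder.Language.{u, 0}) [L.Structure A] {n : ℕ} (V : Set (Fin n → A)) (i : Fin n) :
    CoordAlg L V :=
  Quotient.mk _ (Term.var (Sum.inr i))

@[simp] theorem value_ofBase [L.IsAlgebraic] (a : Fin n → A) (ha : a ∈ V) (c : A) :
    value (L := L) a ha (ofBase L V c) = c := rfl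

@[simp] theorem value_coord (a : Fin n → A) (ha : a ∈ V) (i : Fin n) :
    value (L := L) a ha (coord L V i) = a i := rfl

theorem mk_eq_eval [L.IsAlgebraic] (t : L.Term (A ⊕ Fin n)) :
    Quotient.mk (coordSetoid L V) t = eval (ofBase L V) (coord L V) t := by
  induction t with
  | var x => cases x <;> rfl
  | func F ts ih =>
    rw [← funMap_mk]
    simp only [ih]
    rfl

/-- Satisfaction of atomic formulas in `A[V]` is computed pointwise. -/
theorem realize_iff [L.IsAlgebraic] {α : Type*} {k : ℕ} {φ : L.BoundedFormula α k} (hφ : φ.IsAtomic)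
    (v : α → CoordAlg L V) (xs : Fin k → CoordAlg L V) :
    φ.Realize v xs ↔ ∀ a ha, φ.Realize (value a ha ∘ v) (value a ha ∘ xs) := by
  cases hφ with
  | equal t s =>
    have key : ∀ (a : Fin n → A) (ha : a ∈ V) (t : L.Term (α ⊕ Fin k)),
        t.realize (Sum.elim (value a ha ∘ v) (value a ha ∘ xs)) =
          value a ha (t.realize (Sum.elim v xs)) := fun a ha t => by
      rw [← Sum.comp_elim]
      exact HomClass.realize_term (valueHom a ha)
    simp only [BoundedFormula.realize_bdEqual, key]
    exact ⟨fun h a ha => by rw [h], ext_value⟩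
  | rel R _ => exact isEmptyElim R

end CoordAlg

theorem realize_quasi {α B : Type*} [L.Structure B] {n : ℕ} (Φ : List (L.BoundedFormula α n))
    (ψ : L.BoundedFormula α n) (v : α → B) :
    Formula.Realize ((Φ.foldr (· ⊓ ·) ⊤).imp ψ).alls v ↔
      ∀ xs : Fin n → B, (∀ χ ∈ Φ, χ.Realize v xs) → ψ.Realize v xs := by
  rw [BoundedFormula.realize_alls]
  simp only [BoundedFormula.realize_imp, BoundedFormula.realize_foldr_inf]

/-- Quasi-algebraic formulas are inherited by coordinate algebras. -/
theorem CoordAlg.realize_of_quasi [L.IsAlgebraic] {n : ℕ} {V : Set (Fin n → A)} {α : Type*}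
    {φ : L.Formula α} (hφ : IsQuasiAlgebraic φ) (v : α → CoordAlg L V)
    (h : ∀ a ha, φ.Realize (value a ha ∘ v)) : φ.Realize v := by
  obtain ⟨k, Φ, ψ, hΦ, hψ, rfl⟩ := hφ
  simp only [realize_quasi] at h ⊢
  intro xs hxs
  refine (realize_iff hψ _ _).2 fun a ha => h a ha _ fun χ hχ => ?_
  exact (realize_iff (hΦ χ hχ) _ _).1 (hxs χ hχ) a ha

theorem CoordAlg.modelsQuasiDiagram [L.IsAlgebraic] {n : ℕ} (V : Set (Fin n → A)) :
    ModelsQuasiDiagram (L := L) (ofBase L V) :=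
  fun _ hφ h => realize_of_quasi hφ _ fun _ _ => h

theorem modelsQuasiDiagram_sat {B : Type*} [L.Structure B] {v : A → B}
    (hv : ModelsQuasiDiagram (L := L) v) {n : ℕ} {π : Set (L.BoundedFormula A n)}
    (hπ : IsFiniteAType π) {ψ : L.BoundedFormula A n} (hψ : ψ.IsAtomic)
    (h : ∀ a, Sat π id a → ψ.Realize id a) (b : Fin n → B) (hb : Sat π v b) :
    ψ.Realize v b := by
  have := hv ((hπ.1.toFinset.toList.foldr (· ⊓ ·) ⊤).imp ψ).alls
    ⟨n, _, _, fun χ hχ => hπ.2 χ (by simpa using hχ), hψ, rfl⟩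
    ((realize_quasi _ _ _).2 fun xs hxs => h xs fun χ hχ => hxs χ (by simpa using hχ))
  exact (realize_quasi _ _ _).1 this b fun χ hχ => hb χ (by simpa using hχ)

/-! ### The category of affine algebraic varieties -/

/-- An affine algebraic variety over `A`: a subset of some `Aⁿ` which is the set of rational points
of a finite set of atomic formulas with parameters in `A`. -/
structure AffVar (L : FirstOrder.Language.{u, 0}) (A : Type w) [L.Structure A] where
  /-- The dimension of the ambient affine space. -/
  dim : ℕ
  /-- The underlying set of points. -/
  carrier : Set (Fin dim → A)
  isAffine : ∃ π : Set (L.BoundedFormula A dim), IsFiniteAType π ∧ carrier = zeros π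

/-- A map `f` between affine varieties `V = π₁(A)` and `W = π₂(A)` is a morphism if there is a
finite conjunction `Φ(x, y)` of atomic formulas with parameters in `A` such that, modulo the
quasi-algebraic diagram of `A`, the formula `Φ` is functional in `x`, `π₁(x)` is equivalent to
`∃ y, Φ(x, y)`, `Φ(x, y)` implies `π₂(y)`, and such that `Φ` defines the graph of `f` in `A`. -/
def IsMorphism {V W : AffVar L A} (f : V.carrier → W.carrier) : Prop :=
  ∃ (π₁ : Set (L.BoundedFormula A V.dim)) (π₂ : Set (L.BoundedFormula A W.dim))
    (Φ : Set (L.BoundedFormula A (V.dim + W.dim))),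
    IsFiniteAType π₁ ∧ V.carrier = zeros π₁ ∧ IsFiniteAType π₂ ∧ W.carrier = zeros π₂ ∧
    IsFiniteAType Φ ∧
    (∀ (B : Type (max u w)) [L.Structure B] (v : A → B), ModelsQuasiDiagram (L := L) v →
      (∀ x y y', Sat Φ v (Fin.append x y) → Sat Φ v (Fin.append x y') → y = y') ∧
      (∀ x, Sat π₁ v x ↔ ∃ y, Sat Φ v (Fin.append x y)) ∧
      (∀ x y, Sat Φ v (Fin.append x y) → Sat π₂ v y)) ∧
    ∀ (b : V.carrier) (c : W.carrier), f b = c ↔ Sat Φ id (Fin.append b.1 c.1)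

/-- The substitution of terms for the variables of a term with parameters. -/
def substTerm {n m : ℕ} (ts : Fin m → L.Term (A ⊕ Fin n)) (s : L.Term (A ⊕ Fin m)) :
    L.Term (A ⊕ Fin n) :=
  s.subst (Sum.elim (fun c => Term.var (Sum.inl c)) ts)

theorem eval_substTerm {B : Type*} [L.Structure B] {n m : ℕ} (v : A → B) (b : Fin n → B)
    (ts : Fin m → L.Term (A ⊕ Fin n)) (s : L.Term (A ⊕ Fin m)) :
    eval v b (substTerm ts s) = eval v (fun j => eval v b (ts j)) s := by
  unfold eval substTerm
  rw [Term.realize_subst]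
  congr 1
  funext x
  cases x <;> rfl

/-- The map `f` is given by the terms `ts`. -/
def GivenBy {V W : AffVar L A} (f : V.carrier → W.carrier)
    (ts : Fin W.dim → L.Term (A ⊕ Fin V.dim)) : Prop :=
  ∀ (a : V.carrier) (j : Fin W.dim), (f a).1 j = eval id a.1 (ts j)

theorem value_append {k m n : ℕ} {V : Set (Fin n → A)} (a : Fin n → A) (ha : a ∈ V)
    (x : Fin k → CoordAlg L V) (y : Fin m → CoordAlg L V) :
    CoordAlg.value a ha ∘ Fin.append x y =
      Fin.append (CoordAlg.value a ha ∘ x) (CoordAlg.value a ha ∘ y) := by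
  funext i
  refine Fin.addCases (fun i => ?_) (fun i => ?_) i <;> simp

theorem sat_coordAlg [L.IsAlgebraic] {n k : ℕ} {V : Set (Fin n → A)}
    {π : Set (L.BoundedFormula A k)} (hπ : IsFiniteAType π) (xs : Fin k → CoordAlg L V) :
    Sat π (CoordAlg.ofBase L V) xs ↔ ∀ a ha, Sat π id (CoordAlg.value a ha ∘ xs) := by
  constructor
  · intro h a ha φ hφ
    exact (CoordAlg.realize_iff (hπ.2 φ hφ) _ _).1 (h φ hφ) a ha
  · intro h φ hφ
    exact (CoordAlg.realize_iff (hπ.2 φ hφ) _ _).2 fun a ha => h a ha φ hφ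

/-- A morphism of affine varieties is given by terms. -/
theorem IsMorphism.exists_terms [L.IsAlgebraic] {V W : AffVar L A} {f : V.carrier → W.carrier}
    (hf : IsMorphism f) : ∃ ts, GivenBy f ts := by
  obtain ⟨π₁, π₂, Φ, h₁, hV, h₂, hW, hΦ, hB, hgr⟩ := hf
  obtain ⟨-, hdom, himg⟩ := hB (CoordAlg L V.carrier) _ (CoordAlg.modelsQuasiDiagram V.carrier)
  have hx : Sat π₁ (CoordAlg.ofBase L V.carrier) (CoordAlg.coord L V.carrier) := by
    refine (sat_coordAlg h₁ _).2 fun a ha => ?_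
    have : a ∈ zeros π₁ := hV ▸ ha
    exact this
  obtain ⟨y, hy⟩ := (hdom _).1 hx
  have hy₂ := himg _ _ hy
  obtain ⟨ts, rfl⟩ := CoordAlg.exists_rep y
  refine ⟨ts, fun a j => ?_⟩
  have hc : (fun j => eval id a.1 (ts j)) ∈ W.carrier := by
    rw [hW]
    exact (sat_coordAlg h₂ _).1 hy₂ a.1 a.2
  have := (sat_coordAlg hΦ _).1 hy a.1 a.2
  rw [value_append] at this
  have := (hgr a ⟨_, hc⟩).2 this
  rw [this]

/-- A term in the variables `x₁, …, xₙ`, viewed as a term in the variables `x₁, …, xₙ, y₁, …, yₘ`. -/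
def liftTerm {n : ℕ} (m : ℕ) (t : L.Term (A ⊕ Fin n)) : L.Term (A ⊕ Fin (n + m)) :=
  t.relabel (Sum.map id (Fin.castAdd m))

theorem eval_liftTerm {B : Type*} [L.Structure B] {n m : ℕ} (v : A → B) (x : Fin n → B)
    (y : Fin m → B) (t : L.Term (A ⊕ Fin n)) :
    eval v (Fin.append x y) (liftTerm m t) = eval v x t := by
  unfold eval liftTerm
  rw [Term.realize_relabel]
  congr 1
  funext i
  cases i <;> simp

/-- The formulas `π(x)` together with the equations `tⱼ(x) = yⱼ`. -/
def graphAType {n m : ℕ} (π : Set (L.BoundedFormula A n)) (ts : Fin m → L.Term (A ⊕ Fin n)) :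
    Set (L.BoundedFormula A (n + m)) :=
  BoundedFormula.castLE (Nat.le_add_right n m) '' π ∪ Set.range fun j =>
    (liftTerm m (ts j)).bdEqual (Term.var (Sum.inr (Fin.natAdd n j)))

theorem isFiniteAType_graphAType {n m : ℕ} {π : Set (L.BoundedFormula A n)}
    (hπ : IsFiniteAType π) (ts : Fin m → L.Term (A ⊕ Fin n)) :
    IsFiniteAType (graphAType π ts) := by
  refine ⟨(hπ.1.image _).union (Set.finite_range _), ?_⟩
  rintro φ (⟨χ, hχ, rfl⟩ | ⟨j, rfl⟩)
  · exact (hπ.2 χ hχ).castLE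
  · exact .equal _ _

theorem realize_castLE [L.IsAlgebraic] {B : Type*} [L.Structure B] {n m : ℕ} (v : A → B)
    (x : Fin n → B) (y : Fin m → B) {φ : L.BoundedFormula A n} (hφ : φ.IsAtomic) :
    (φ.castLE (Nat.le_add_right n m)).Realize v (Fin.append x y) ↔ φ.Realize v x := by
  cases hφ with
  | equal t s =>
    rw [BoundedFormula.realize_bdEqual]
    refine (BoundedFormula.realize_bdEqual _ _).trans ?_
    exact (congrArg₂ (· = ·) (eval_liftTerm v x y t) (eval_liftTerm v x y s)).to_iff
  | rel R _ => exact isEmptyElim R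

theorem sat_graphAType [L.IsAlgebraic] {B : Type*} [L.Structure B] {n m : ℕ}
    {π : Set (L.BoundedFormula A n)} (hπ : IsFiniteAType π) (ts : Fin m → L.Term (A ⊕ Fin n))
    (v : A → B) (x : Fin n → B) (y : Fin m → B) :
    Sat (graphAType π ts) v (Fin.append x y) ↔ Sat π v x ∧ ∀ j, eval v x (ts j) = y j := by
  constructor
  · refine fun h => ⟨fun φ hφ => ?_, fun j => ?_⟩
    · exact (realize_castLE v x y (hπ.2 φ hφ)).1 (h _ (.inl ⟨φ, hφ, rfl⟩))
    · have := (BoundedFormula.realize_bdEqual _ _).1 (h _ (.inr ⟨j, rfl⟩))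
      rw [← eval_liftTerm v x y]
      exact this.trans (by simp)
  · rintro ⟨hx, hy⟩ φ (⟨χ, hχ, rfl⟩ | ⟨j, rfl⟩)
    · exact (realize_castLE v x y (hπ.2 χ hχ)).2 (hx χ hχ)
    · exact (BoundedFormula.realize_bdEqual _ _).2
        ((eval_liftTerm v x y _).trans ((hy j).trans (by simp)))

/-- A map between affine varieties which is given by terms is a morphism. -/
theorem GivenBy.isMorphism [L.IsAlgebraic] {V W : AffVar L A} {f : V.carrier → W.carrier}
    {ts : Fin W.dim → L.Term (A ⊕ Fin V.dim)} (hf : GivenBy f ts) : IsMorphism f := by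
  obtain ⟨π₁, h₁, hV⟩ := V.isAffine
  obtain ⟨π₂, h₂, hW⟩ := W.isAffine
  refine ⟨π₁, π₂, graphAType π₁ ts, h₁, hV, h₂, hW, isFiniteAType_graphAType h₁ ts,
    fun B _ v hv => ⟨?_, ?_, ?_⟩, ?_⟩
  · intro x y y' h h'
    rw [sat_graphAType h₁] at h h'
    funext j
    rw [← h.2 j, ← h'.2 j]
  · refine fun x => ⟨fun h => ⟨fun j => eval v x (ts j),
      (sat_graphAType h₁ ts v x _).2 ⟨h, fun _ => rfl⟩⟩, ?_⟩
    rintro ⟨y, hy⟩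
    exact ((sat_graphAType h₁ ts v x y).1 hy).1
  · intro x y h φ hφ
    obtain ⟨hx, hy⟩ := (sat_graphAType h₁ ts v x y).1 h
    have hy' : y = fun j => eval v x (ts j) := funext fun j => (hy j).symm
    cases h₂.2 φ hφ with
    | equal t s =>
      rw [BoundedFormula.realize_bdEqual, hy']
      have key := modelsQuasiDiagram_sat hv h₁
        (ψ := (substTerm ts t).bdEqual (substTerm ts s)) (.equal _ _) (fun a ha => ?_) x hx
      · have := (BoundedFormula.realize_bdEqual _ _).1 key
        exact (eval_substTerm v x ts t).symm.trans (this.trans (eval_substTerm v x ts s))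
      · refine (BoundedFormula.realize_bdEqual _ _).2 ?_
        have haV : a ∈ V.carrier := hV ▸ ha
        have hfa : (f ⟨a, haV⟩).1 ∈ zeros π₂ := hW ▸ (f ⟨a, haV⟩).2
        have hts : (f ⟨a, haV⟩).1 = fun j => eval id a (ts j) := funext fun j => hf ⟨a, haV⟩ j
        rw [hts] at hfa
        have := (BoundedFormula.realize_bdEqual _ _).1 (hfa _ hφ)
        exact (eval_substTerm id a ts t).trans (this.trans (eval_substTerm id a ts s).symm)
    | rel R _ => exact isEmptyElim R
  · intro b c
    rw [sat_graphAType h₁]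
    have hb : Sat π₁ id b.1 := by
      have : b.1 ∈ zeros π₁ := hV ▸ b.2
      exact this
    constructor
    · rintro rfl
      exact ⟨hb, fun j => (hf b j).symm⟩
    · rintro ⟨-, h⟩
      exact Subtype.ext (funext fun j => (hf b j).trans (h j))

theorem GivenBy.comp {V W Z : AffVar L A} {f : V.carrier → W.carrier}
    {g : W.carrier → Z.carrier} {ts : Fin W.dim → L.Term (A ⊕ Fin V.dim)}
    {us : Fin Z.dim → L.Term (A ⊕ Fin W.dim)} (hf : GivenBy f ts) (hg : GivenBy g us) :
    GivenBy (g ∘ f) fun j => substTerm ts (us j) := by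
  intro a j
  rw [eval_substTerm]
  refine (hg (f a) j).trans ?_
  congr 2
  funext i
  exact hf a i

/-- The category of affine algebraic varieties over `A`. -/
instance affCategory [L.IsAlgebraic] : CategoryTheory.Category.{w} (AffVar L A) where
  Hom V W := {f : V.carrier → W.carrier // IsMorphism f}
  id V := ⟨id, GivenBy.isMorphism (ts := fun j => Term.var (Sum.inr j)) fun _ _ => rfl⟩
  comp f g := ⟨g.1 ∘ f.1, by
    obtain ⟨ts, hf⟩ := f.2.exists_terms
    obtain ⟨us, hg⟩ := g.2.exists_terms
    exact (hf.comp hg).isMorphism⟩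

/-! ### Reduced `A`-algebras and the coordinate algebra functor -/

/-- A reduced `A`-algebra: a homomorphism from `A` to a model of the quasi-algebraic consequences
of `T`. -/
structure ReducedAlg (T : L.Theory) (A : Type w) [L.Structure A] where
  /-- The underlying set. -/
  carrier : Type (max u w)
  [str : L.Structure carrier]
  reduced : carrier ⊨ quasiTheory T
  /-- The structure morphism. -/
  hom : A →[L] carrier

attribute [instance] ReducedAlg.str

/-- Morphisms of `A`-algebras. -/
@[ext] structure ReducedAlg.Hom {T : L.Theory} (B C : ReducedAlg T A) where
  /-- The underlying homomorphism. -/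
  toHom : B.carrier →[L] C.carrier
  comp_hom : ∀ a, toHom (B.hom a) = C.hom a

instance reducedAlgCategory (T : L.Theory) :
    CategoryTheory.Category.{max u w} (ReducedAlg T A) where
  Hom B C := ReducedAlg.Hom B C
  id B := ⟨Language.Hom.id L B.carrier, fun _ => rfl⟩
  comp f g := ⟨g.toHom.comp f.toHom, fun a => by
    rw [Language.Hom.comp_apply, f.comp_hom, g.comp_hom]⟩

/-- An `A`-algebra is finitely generated if it is generated, as a structure, by the image of `A`
and finitely many elements. -/
def isFinGen (T : L.Theory) (A : Type w) [L.Structure A] :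
    CategoryTheory.ObjectProperty (ReducedAlg T A) :=
  fun B => ∃ S : Set B.carrier, S.Finite ∧
    Substructure.closure L (Set.range B.hom ∪ S) = ⊤

/-- The category of finitely generated reduced `A`-algebras. -/
abbrev FinGenReducedAlg (T : L.Theory) (A : Type w) [L.Structure A] :=
  (isFinGen T A).FullSubcategory

theorem models_quasiTheory (T : L.Theory) [A ⊨ T] [Nonempty A] : A ⊨ quasiTheory T :=
  ⟨fun _ h => h.2.realize_sentence A⟩

theorem coordAlg_reduced [L.IsAlgebraic] (T : L.Theory) [A ⊨ T] [Nonempty A] {n : ℕ}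
    (V : Set (Fin n → A)) : CoordAlg L V ⊨ quasiTheory T :=
  ⟨fun φ h => CoordAlg.realize_of_quasi h.1 _ fun a ha => by
    have := (models_quasiTheory (A := A) T).realize_of_mem φ h
    rw [Sentence.Realize] at this
    convert this⟩

/-- The coordinate algebra of an affine variety, as a reduced `A`-algebra. -/
def coordObj [L.IsAlgebraic] (T : L.Theory) [A ⊨ T] [Nonempty A] (V : AffVar L A) :
    ReducedAlg T A where
  carrier := CoordAlg L V.carrier
  reduced := coordAlg_reduced T _
  hom := CoordAlg.ofBase L V.carrier

theorem coordObj_finGen [L.IsAlgebraic] (T : L.Theory) [A ⊨ T] [Nonempty A] (V : AffVar L A) :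
    isFinGen T A (coordObj T V) := by
  refine ⟨Set.range (CoordAlg.coord L V.carrier), Set.finite_range _, ?_⟩
  refine eq_top_iff.2 fun p _ => ?_
  induction p using Quotient.inductionOn with
  | h t =>
    rw [CoordAlg.mk_eq_eval]
    refine Term.realize_mem t _ fun x => Substructure.subset_closure ?_
    cases x with
    | inl c => exact .inl ⟨c, rfl⟩
    | inr i => exact .inr ⟨i, rfl⟩

/-- The homomorphism `A[W] → A[V]` sending the class of `yⱼ` to the class of `tⱼ`, if the
terms `tⱼ` map `V` into `W`. -/
def CoordAlg.comap [L.IsAlgebraic] {n m : ℕ} {V : Set (Fin n → A)} {W : Set (Fin m → A)}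
    (ts : Fin m → L.Term (A ⊕ Fin n)) (h : ∀ a ∈ V, (fun j => eval id a (ts j)) ∈ W) :
    CoordAlg L W →[L] CoordAlg L V where
  toFun := Quotient.map (substTerm ts) fun s s' hs => equal_mem_aType.2 fun a ha => by
    rw [eval_substTerm, eval_substTerm]
    exact equal_mem_aType.1 hs _ (h a ha)
  map_fun' F x := by
    obtain ⟨us, rfl⟩ := exists_rep x
    rw [funMap_mk]
    exact (funMap_mk F fun i => substTerm ts (us i)).symm
  map_rel' r := isEmptyElim r

theorem CoordAlg.value_comap [L.IsAlgebraic] {n m : ℕ} {V : Set (Fin n → A)}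
    {W : Set (Fin m → A)} (ts : Fin m → L.Term (A ⊕ Fin n))
    (h : ∀ a ∈ V, (fun j => eval id a (ts j)) ∈ W) (a : Fin n → A) (ha : a ∈ V)
    (p : CoordAlg L W) :
    value a ha (comap ts h p) = value (fun j => eval id a (ts j)) (h a ha) p := by
  induction p using Quotient.inductionOn with
  | h s => exact eval_substTerm id a ts s

theorem GivenBy.mem {V W : AffVar L A} {f : V.carrier → W.carrier}
    {ts : Fin W.dim → L.Term (A ⊕ Fin V.dim)} (hf : GivenBy f ts) (a : Fin V.dim → A)
    (ha : a ∈ V.carrier) : (fun j => eval id a (ts j)) ∈ W.carrier := by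
  have : (fun j => eval id a (ts j)) = (f ⟨a, ha⟩).1 := funext fun j => (hf ⟨a, ha⟩ j).symm
  rw [this]
  exact (f ⟨a, ha⟩).2

/-- The homomorphism `A[f] : A[W] → A[V]` induced by a morphism `f : V → W`: it sends the class
of `yⱼ` to the class of `tⱼ`, where the terms `tⱼ` represent `f`. -/
noncomputable def coordMap [L.IsAlgebraic] (T : L.Theory) [A ⊨ T] [Nonempty A] {V W : AffVar L A}
    (f : V ⟶ W) : coordObj T W ⟶ coordObj T V :=
  ReducedAlg.Hom.mk
    (CoordAlg.comap f.2.exists_terms.choose f.2.exists_terms.choose_spec.mem) fun _ => rfl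

theorem value_coordMap [L.IsAlgebraic] (T : L.Theory) [A ⊨ T] [Nonempty A] {V W : AffVar L A}
    (f : V ⟶ W) (a : Fin V.dim → A) (ha : a ∈ V.carrier) (p : CoordAlg L W.carrier) :
    CoordAlg.value a ha ((coordMap T f).toHom p) =
      CoordAlg.value (f.1 ⟨a, ha⟩).1 (f.1 ⟨a, ha⟩).2 p := by
  refine (CoordAlg.value_comap _ f.2.exists_terms.choose_spec.mem a ha p).trans ?_
  congr 1
  funext j
  exact (f.2.exists_terms.choose_spec ⟨a, ha⟩ j).symm

/-- The (contravariant) coordinate algebra functor, from affine varieties over `A` to reduced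
`A`-algebras. -/
noncomputable def coordFunctor [L.IsAlgebraic] (T : L.Theory) [A ⊨ T] [Nonempty A] :
    (AffVar L A)ᵒᵖ ⥤ ReducedAlg T A where
  obj V := coordObj T V.unop
  map f := coordMap T f.unop
  map_id V := by
    refine ReducedAlg.Hom.ext (Language.Hom.ext fun p => CoordAlg.ext_value fun a ha => ?_)
    exact value_coordMap T (𝟙 V.unop) a ha p
  map_comp f g := by
    refine ReducedAlg.Hom.ext (Language.Hom.ext fun p => CoordAlg.ext_value fun a ha => ?_)
    refine (value_coordMap T (g.unop ≫ f.unop) a ha p).trans ?_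
    refine Eq.trans ?_ (value_coordMap T g.unop a ha ((coordMap T f.unop).toHom p)).symm
    exact (value_coordMap T f.unop _ _ p).symm

/-- The coordinate algebra functor, with values in finitely generated reduced `A`-algebras. -/
noncomputable def coordFunctorFin [L.IsAlgebraic] (T : L.Theory) (A : Type w) [L.Structure A]
    [A ⊨ T] [Nonempty A] : (AffVar L A)ᵒᵖ ⥤ FinGenReducedAlg T A :=
  (isFinGen T A).lift (coordFunctor T) fun V => coordObj_finGen T V.unop

end Affine

/-! ### Group-based algebras -/

/-- Function symbols `*`, `⁻¹`, `e` of a language, for the group operations. -/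
structure GroupSymbols (L : FirstOrder.Language.{u, 0}) where
  /-- The symbol of the product. -/
  mul : L.Functions 2
  /-- The symbol of the inverse. -/
  inv : L.Functions 1
  /-- The symbol of the neutral element. -/
  one : L.Constants

namespace GroupSymbols

variable {L : FirstOrder.Language.{u, 0}} (G : GroupSymbols L) {B : Type*} [L.Structure B]

/-- The product `x * y`. -/
def op (x y : B) : B := Structure.funMap G.mul ![x, y]

/-- The inverse `x⁻¹`. -/
def inverse (x : B) : B := Structure.funMap G.inv ![x]

/-- The neutral element `e`. -/
def e (B : Type*) [L.Structure B] : B := Structure.funMap G.one ![]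

/-- `B` is a group-based algebra: a group in which every function symbol of positive arity maps
`(e, …, e)` to `e`. -/
structure IsGroupBased (B : Type*) [L.Structure B] : Prop where
  assoc : ∀ x y z : B, G.op (G.op x y) z = G.op x (G.op y z)
  e_op : ∀ x : B, G.op (G.e B) x = x
  op_e : ∀ x : B, G.op x (G.e B) = x
  inverse_op : ∀ x : B, G.op (G.inverse x) x = G.e B
  op_inverse : ∀ x : B, G.op x (G.inverse x) = G.e B
  map_e : ∀ {n : ℕ} (F : L.Functions n), 0 < n →
    Structure.funMap F (fun _ => G.e B) = G.e B

/-- `T` is a theory of group-based algebras: all its models are group-based algebras. -/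
def IsGroupBasedTheory (T : L.Theory) : Prop :=
  ∀ (M : Type u) [L.Structure M] [Nonempty M] [M ⊨ T], G.IsGroupBased M

/-- An ideal of a group-based algebra: a normal subgroup `I` such that, for every function symbol
`F` of positive arity, `F(a)` and `F(a)⁻¹ * F(b)⁻¹ * F(a * b)` belong to `I` for all tuples `a` of
elements of `I` and all tuples `b`. -/
structure IsIdeal (I : Set B) : Prop where
  e_mem : G.e B ∈ I
  op_mem : ∀ {x y : B}, x ∈ I → y ∈ I → G.op x y ∈ I
  inverse_mem : ∀ {x : B}, x ∈ I → G.inverse x ∈ I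
  conj_mem : ∀ {x : B} (y : B), x ∈ I → G.op (G.op y x) (G.inverse y) ∈ I
  map_mem : ∀ {n : ℕ} (F : L.Functions n), 0 < n → ∀ a : Fin n → B, (∀ i, a i ∈ I) →
    Structure.funMap F a ∈ I
  commutator_mem : ∀ {n : ℕ} (F : L.Functions n), 0 < n → ∀ a b : Fin n → B, (∀ i, a i ∈ I) →
    G.op (G.op (G.inverse (Structure.funMap F a)) (G.inverse (Structure.funMap F b)))
      (Structure.funMap F fun i => G.op (a i) (b i)) ∈ I

/-- `I` is finitely generated as an ideal: it is the smallest ideal containing some finite set. -/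
def IsFinGenIdeal (I : Set B) : Prop :=
  ∃ S : Set B, S.Finite ∧ S ⊆ I ∧ ∀ J : Set B, G.IsIdeal J → S ⊆ J → I ⊆ J

section Group

variable {G}

/-- The group underlying a group-based algebra. -/
@[reducible] def IsGroupBased.toGroup (hB : G.IsGroupBased B) : Group B where
  mul := G.op
  one := G.e B
  inv := G.inverse
  mul_assoc := hB.assoc
  one_mul := hB.e_op
  mul_one := hB.op_e
  inv_mul_cancel := hB.inverse_op

/-- Congruence modulo an ideal `I`: `x ∼ y` if and only if `x * y⁻¹ ∈ I`. -/
def idealSetoid (hB : G.IsGroupBased B) {I : Set B} (hI : G.IsIdeal I) : Setoid B where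
  r x y := G.op x (G.inverse y) ∈ I
  iseqv := by
    let _ := hB.toGroup
    refine ⟨fun x => ?_, fun {x y} h => ?_, fun {x y z} h h' => ?_⟩
    · rw [hB.op_inverse]
      exact hI.e_mem
    · have : (x * y⁻¹)⁻¹ ∈ I := hI.inverse_mem h
      rwa [mul_inv_rev, inv_inv] at this
    · have : (x * y⁻¹) * (y * z⁻¹) ∈ I := hI.op_mem h h'
      rwa [mul_assoc, inv_mul_cancel_left] at this

/-- The structure of the quotient `B/I` of a group-based algebra by an ideal. -/
@[reducible] def idealPrestructure [L.IsAlgebraic] (hB : G.IsGroupBased B) {I : Set B}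
    (hI : G.IsIdeal I) : L.Prestructure (idealSetoid hB hI) where
  toStructure := inferInstance
  fun_equiv {n F} x y h := by
    let _ := hB.toGroup
    rcases Nat.eq_zero_or_pos n with rfl | hn
    · have : x = y := Subsingleton.elim _ _
      rw [this]
    · have ha : ∀ i, x i * (y i)⁻¹ ∈ I := h
      have h1 : Structure.funMap F (fun i => x i * (y i)⁻¹) ∈ I := hI.map_mem F hn _ ha
      have h2 : (Structure.funMap F fun i => x i * (y i)⁻¹)⁻¹ * (Structure.funMap F y)⁻¹ *
          (Structure.funMap F fun i => x i * (y i)⁻¹ * y i) ∈ I := hI.commutator_mem F hn _ y ha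
      simp only [inv_mul_cancel_right] at h2
      have h3 := hI.op_mem h1 h2
      have h4 : (Structure.funMap F y)⁻¹ * Structure.funMap F x ∈ I := by
        change Structure.funMap F (fun i => x i * (y i)⁻¹) *
          ((Structure.funMap F fun i => x i * (y i)⁻¹)⁻¹ * (Structure.funMap F y)⁻¹ *
            Structure.funMap F x) ∈ I at h3
        rwa [mul_assoc, mul_inv_cancel_left] at h3
      have h5 : Structure.funMap F y * ((Structure.funMap F y)⁻¹ * Structure.funMap F x) *
          (Structure.funMap F y)⁻¹ ∈ I := hI.conj_mem _ h4
      rw [mul_inv_cancel_left] at h5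
      exact h5
  rel_equiv {n r} := isEmptyElim r

/-- An ideal `I` of `B` is radical (relatively to `T`) if `B/I` is a model of the quasi-algebraic
consequences of `T`. -/
def IsRadicalIdeal [L.IsAlgebraic] (T : L.Theory) (hB : G.IsGroupBased B) {I : Set B}
    (hI : G.IsIdeal I) : Prop :=
  letI := idealPrestructure hB hI
  Quotient (idealSetoid hB hI) ⊨ quasiTheory T

end Group

end GroupSymbols

section Polynomials

variable {L : FirstOrder.Language.{u, 0}} {A : Type w} [L.Structure A]

/-- Two terms with parameters in `A` and variables `x₁, …, xₙ` define the same polynomial if they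
have the same value at all points of all `A`-algebras in the variety generated by the models
of `T`. -/
def polySetoid (T : L.Theory) (A : Type w) [L.Structure A] (n : ℕ) :
    Setoid (L.Term (A ⊕ Fin n)) where
  r t s := ∀ (B : Type (max u w)) [L.Structure B] [B ⊨ algTheory T] (f : A →[L] B)
    (b : Fin n → B), eval f b t = eval f b s
  iseqv :=
    { refl := fun _ _ _ _ _ _ => rfl
      symm := fun h B _ _ f b => (h B f b).symm
      trans := fun h h' B _ _ f b => (h B f b).trans (h' B f b) }

instance polyPrestructure [L.IsAlgebraic] (T : L.Theory) (A : Type w) [L.Structure A] (n : ℕ) :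
    L.Prestructure (polySetoid T A n) where
  toStructure := termStructure L _
  fun_equiv {k F} x y h := fun B _ _ f b => by
    change Structure.funMap F (fun i => eval f b (x i)) =
      Structure.funMap F (fun i => eval f b (y i))
    congr 1
    funext i
    exact h i B f b
  rel_equiv {k r} := isEmptyElim r

/-- The algebra of polynomials `A[X₁, …, Xₙ]` in the variety generated by the models of `T`: the
`A`-algebra freely generated by `X₁, …, Xₙ` in this variety. -/
abbrev PolyAlg (T : L.Theory) (A : Type w) [L.Structure A] (n : ℕ) : Type (max u w) :=
  Quotient (polySetoid T A n)

/-- An equation between terms that holds in all models of `T` holds in all models of its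
algebraic consequences. -/
theorem algTheory_equation {T : L.Theory} {k : ℕ} (t s : L.Term (Empty ⊕ Fin k))
    (h : ∀ (M : Type u) [L.Structure M] [Nonempty M] [M ⊨ T] (x : Fin k → M),
      t.realize (Sum.elim Empty.elim x) = s.realize (Sum.elim Empty.elim x))
    {B : Type*} [L.Structure B] [hB : B ⊨ algTheory T] (x : Fin k → B) :
    t.realize (Sum.elim Empty.elim x) = s.realize (Sum.elim Empty.elim x) := by
  have hmem : (t.bdEqual s).alls ∈ algTheory T := by
    refine ⟨⟨k, _, .equal _ _, rfl⟩, Theory.models_sentence_iff.2 fun M => ?_⟩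
    refine BoundedFormula.realize_alls.2 fun xs => ?_
    rw [BoundedFormula.realize_bdEqual]
    convert h M xs
  have := BoundedFormula.realize_alls.1 (hB.realize_of_mem _ hmem) x
  rw [BoundedFormula.realize_bdEqual] at this
  convert this

theorem realize_mulTerm (G : GroupSymbols L) {B : Type*} [L.Structure B] {α : Type*}
    (t s : L.Term α) (v : α → B) :
    (Term.func G.mul ![t, s]).realize v = G.op (t.realize v) (s.realize v) :=
  congrArg (Structure.funMap G.mul) (funext fun i => by fin_cases i <;> rfl)

theorem realize_invTerm (G : GroupSymbols L) {B : Type*} [L.Structure B] {α : Type*}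
    (t : L.Term α) (v : α → B) :
    (Term.func G.inv ![t]).realize v = G.inverse (t.realize v) :=
  congrArg (Structure.funMap G.inv) (funext fun i => by fin_cases i; rfl)

theorem realize_oneTerm (G : GroupSymbols L) {B : Type*} [L.Structure B] {α : Type*}
    (v : α → B) : (Term.func G.one ![] : L.Term α).realize v = G.e B :=
  congrArg (Structure.funMap G.one) (funext fun i => i.elim0)

/-- The models of the algebraic consequences of a theory of group-based algebras are group-based
algebras. -/
theorem isGroupBased_of_algTheory {G : GroupSymbols L} {T : L.Theory}
    (hT : G.IsGroupBasedTheory T) {B : Type*} [L.Structure B] [B ⊨ algTheory T] :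
    G.IsGroupBased B := by
  let X {k : ℕ} (i : Fin k) : L.Term (Empty ⊕ Fin k) := Term.var (Sum.inr i)
  let m {k : ℕ} (t s : L.Term (Empty ⊕ Fin k)) : L.Term (Empty ⊕ Fin k) :=
    Term.func G.mul ![t, s]
  let v {k : ℕ} (t : L.Term (Empty ⊕ Fin k)) : L.Term (Empty ⊕ Fin k) := Term.func G.inv ![t]
  let o {k : ℕ} : L.Term (Empty ⊕ Fin k) := Term.func G.one ![]
  refine ⟨fun x y z => ?_, fun x => ?_, fun x => ?_, fun x => ?_, fun x => ?_, fun {n} F hn => ?_⟩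
  · have := algTheory_equation (T := T) (m (m (X 0) (X 1)) (X 2)) (m (X 0) (m (X 1) (X 2)))
      (fun M _ _ _ x => by
        simp only [m, X, realize_mulTerm]
        exact (hT M).assoc _ _ _) ![x, y, z]
    simp only [m, X, realize_mulTerm] at this
    exact this
  · have := algTheory_equation (T := T) (m o (X 0)) (X 0) (fun M _ _ _ x => by
        simp only [m, X, o, realize_mulTerm, realize_oneTerm]
        exact (hT M).e_op _) ![x]
    simp only [m, X, o, realize_mulTerm, realize_oneTerm] at this
    exact this
  · have := algTheory_equation (T := T) (m (X 0) o) (X 0) (fun M _ _ _ x => by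
        simp only [m, X, o, realize_mulTerm, realize_oneTerm]
        exact (hT M).op_e _) ![x]
    simp only [m, X, o, realize_mulTerm, realize_oneTerm] at this
    exact this
  · have := algTheory_equation (T := T) (m (v (X 0)) (X 0)) o (fun M _ _ _ x => by
        simp only [m, X, o, v, realize_mulTerm, realize_oneTerm, realize_invTerm]
        exact (hT M).inverse_op _) ![x]
    simp only [m, X, o, v, realize_mulTerm, realize_oneTerm, realize_invTerm] at this
    exact this
  · have := algTheory_equation (T := T) (m (X 0) (v (X 0))) o (fun M _ _ _ x => by
        simp only [m, X, o, v, realize_mulTerm, realize_oneTerm, realize_invTerm]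
        exact (hT M).op_inverse _) ![x]
    simp only [m, X, o, v, realize_mulTerm, realize_oneTerm, realize_invTerm] at this
    exact this
  · have := algTheory_equation (T := T) (Term.func F fun _ => o) (o (k := 0))
      (fun M _ _ _ x => by
        have ho := realize_oneTerm G (Sum.elim Empty.elim x : Empty ⊕ Fin 0 → M)
        rw [ho, Term.realize_func]
        exact (congrArg (Structure.funMap F) (funext fun _ => ho)).trans ((hT M).map_e F hn))
      (B := B) ![]
    have ho := realize_oneTerm G (Sum.elim Empty.elim ![] : Empty ⊕ Fin 0 → B)
    rw [ho, Term.realize_func] at this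
    exact (congrArg (Structure.funMap F) (funext fun _ => ho.symm)).trans this

/-- The algebra of polynomials belongs to the variety generated by the models of `T`. -/
theorem polyAlg_models [L.IsAlgebraic] (T : L.Theory) (A : Type w) [L.Structure A] (n : ℕ) :
    PolyAlg T A n ⊨ algTheory T := by
  refine ⟨fun φ hφ => ?_⟩
  obtain ⟨k, ψ, hψ, rfl⟩ := id hφ.1
  refine BoundedFormula.realize_alls.2 fun xs => ?_
  cases hψ with
  | rel R _ => exact isEmptyElim R
  | equal t s =>
    rw [BoundedFormula.realize_bdEqual]
    let r : Empty ⊕ Fin k → L.Term (A ⊕ Fin n) := Sum.elim Empty.elim fun i => (xs i).out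
    have hr : Sum.elim default xs = fun i => Quotient.mk (polySetoid T A n) (r i) := by
      funext i
      rcases i with i | i
      · exact i.elim
      · exact (Quotient.out_eq (xs i)).symm
    have key (t : L.Term (Empty ⊕ Fin k)) :
        @Term.realize L _ (termStructure L _) _ r t = t.subst r := by
      induction t with
      | var => rfl
      | func F ts ih => exact congrArg (Term.func F) (funext ih)
    rw [hr]
    refine (Term.realize_quotient_mk' (polySetoid T A n) t r).trans
      (Eq.trans ?_ (Term.realize_quotient_mk' (polySetoid T A n) s r).symm)
    refine Quotient.sound fun B _ hB f b => ?_
    refine (congrArg (eval f b) (key t)).trans (Eq.trans ?_ (congrArg (eval f b) (key s)).symm)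
    unfold eval
    rw [Term.realize_subst, Term.realize_subst]
    have := BoundedFormula.realize_alls.1 (hB.realize_of_mem _ hφ)
      fun i => eval f b (r (Sum.inr i))
    rw [BoundedFormula.realize_bdEqual] at this
    convert this using 3 <;>
    · rename_i i
      rcases i with i | i
      · exact i.elim
      · rfl

theorem isGroupBased_polyAlg [L.IsAlgebraic] {G : GroupSymbols L} {T : L.Theory}
    (hT : G.IsGroupBasedTheory T) (A : Type w) [L.Structure A] (n : ℕ) :
    G.IsGroupBased (PolyAlg T A n) :=
  have := polyAlg_models T A n
  isGroupBased_of_algTheory hT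

/-- `A` is radically noetherian (relatively to `T`): every radical ideal of an algebra of
polynomials `A[X₁, …, Xₙ]` is finitely generated as an ideal. -/
def RadicallyNoetherian [L.IsAlgebraic] {G : GroupSymbols L} {T : L.Theory}
    (hT : G.IsGroupBasedTheory T) (A : Type w) [L.Structure A] : Prop :=
  ∀ (n : ℕ) (I : Set (PolyAlg T A n)) (hI : G.IsIdeal I),
    GroupSymbols.IsRadicalIdeal T (isGroupBased_polyAlg hT A n) hI → G.IsFinGenIdeal I

end Polynomials

end GeomAlg

/-!
The coordinate algebra functor is fully faithful with no hypothesis on `A`: a homomorphism of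
`A`-algebras `A[W] → A[V]` is determined by the images of the coordinate functions of `W`, and terms
representing these images define a map `V → W`, because the equations of `W` are preserved by
homomorphisms and an equation holds in `A[V]` if and only if it holds at all points of `V`.

The hypotheses serve for essential surjectivity. Let `B` be a reduced `A`-algebra generated over `A`
by `b₁, …, bₙ`. The kernel of the evaluation `A[X₁, …, Xₙ] → B` at `b` is a radical ideal, because
the quotient is isomorphic to `B` (`isRadicalIdeal_kernel`), so it is generated by a finite set `S`.
Let `V ⊆ Aⁿ` be the variety defined by the equations `p = e` for `p ∈ S`; then `B ≅ A[V]`, i.e. the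
equations satisfied by `b` are those that hold on `V` (`exists_affVar_eval_eq_iff`):

* the kernel of `A[X₁, …, Xₙ] → A[V]` is an ideal containing `S`, so that it contains all the
  relations between the `bᵢ`;
* conversely, if `t = s` on `V`, then the quasi-algebraic sentence `∀ x, ⋀ p(x) = e → t(x) = s(x)`
  holds in `A`, and it has to be transferred to `B`.

Geometric closedness provides this transfer only for homomorphisms into models of `T`. To reach the
models of the quasi-algebraic consequences of `T`, one uses that homomorphisms into models of `T`
separate the points of such a structure `B` (`exists_hom_separating`): by compactness, `T` together
with the positive diagram of `B` and one inequality `p ≠ q` true in `B` is consistent, since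
otherwise finitely many equations of the diagram would imply `p = q` modulo `T`, and this implication
would be a quasi-algebraic consequence of `T` violated in `B`.
-/

namespace GeomAlg

open FirstOrder.Language CategoryTheory

/-! ### Separating the points of a reduced algebra -/

section Separation

variable {L : FirstOrder.Language.{u, 0}}

theorem models_algTheory_of_models_quasiTheory {T : L.Theory} {B : Type*} [L.Structure B]
    [hB : B ⊨ quasiTheory T] : B ⊨ algTheory T := by
  refine ⟨fun φ hφ => ?_⟩
  obtain ⟨⟨n, ψ, hψ, rfl⟩, hT⟩ := hφ
  -- `∀ x, ψ` is not syntactically quasi-algebraic: it is replaced by `∀ x, ⊤ → ψ`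
  have hmem : ((([] : List (L.BoundedFormula Empty n)).foldr (· ⊓ ·) ⊤).imp ψ).alls ∈
      quasiTheory T := by
    refine ⟨⟨n, [], ψ, by simp, hψ, rfl⟩, Theory.models_sentence_iff.2 fun M => ?_⟩
    have := Theory.models_sentence_iff.1 hT M
    exact (realize_quasi _ _ _).2 fun xs _ => BoundedFormula.realize_alls.1 this xs
  have := (realize_quasi _ _ _).1 (hB.realize_of_mem _ hmem)
  exact BoundedFormula.realize_alls.2 fun xs => this xs (by simp)

theorem realize_isAtomic_of_hom [L.IsAlgebraic] {α B C : Type*} [L.Structure B] [L.Structure C]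
    (g : B →[L] C) {n : ℕ} {φ : L.BoundedFormula α n} (hφ : φ.IsAtomic) {v : α → B}
    {xs : Fin n → B} (h : φ.Realize v xs) : φ.Realize (g ∘ v) (g ∘ xs) := by
  cases hφ with
  | rel R _ => exact isEmptyElim R
  | equal t s =>
    rw [BoundedFormula.realize_bdEqual] at h ⊢
    rw [← Sum.comp_elim, HomClass.realize_term, HomClass.realize_term, h]

theorem realize_restrictVar_inr {B C : Type*} [DecidableEq B] [L.Structure C] {n : ℕ}
    {V : Finset B} (e : V → Fin n) {xs : Fin n → C} {v : B → C}
    (hv : ∀ b (hb : b ∈ V), v b = xs (e ⟨b, hb⟩)) {t : L.Term B} (h : t.varFinset ⊆ V) :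
    (t.restrictVar fun b => (Sum.inr (e ⟨b, h b.2⟩) : Empty ⊕ Fin n)).realize
      (Sum.elim default xs) = t.realize v :=
  Term.realize_restrictVar v fun b => (hv b (h b.2)).symm

/-- If `B` satisfies the quasi-algebraic consequences of `T`, any finite set `s` of equations
between elements of `B` and any inequality `p ≠ q` in `B` can be realized simultaneously in a model
of `T`. -/
theorem exists_model_realizing_finite {T : L.Theory} {B : Type*}
    [L.Structure B] [hB : B ⊨ quasiTheory T] {p q : B} (hpq : p ≠ q)
    (s : Finset (L.Term B × L.Term B)) (hs : ∀ i ∈ s, i.1.realize id = i.2.realize (id : B → B)) :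
    ∃ (M : Theory.ModelType.{u, 0, u} T) (v : B → M), v p ≠ v q ∧
      ∀ i ∈ s, i.1.realize v = i.2.realize v := by
  classical
  by_contra! hcon
  -- the finitely many elements of `B` that occur
  let V : Finset B := insert p (insert q (s.biUnion fun i => i.1.varFinset ∪ i.2.varFinset))
  have hp : p ∈ V := by simp [V]
  have hq : q ∈ V := by simp [V]
  have hV₁ : ∀ i ∈ s, i.1.varFinset ⊆ V := fun i hi b hb => by
    simp only [V, Finset.mem_insert, Finset.mem_biUnion, Finset.mem_union]
    exact .inr (.inr ⟨i, hi, .inl hb⟩)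
  have hV₂ : ∀ i ∈ s, i.2.varFinset ⊆ V := fun i hi b hb => by
    simp only [V, Finset.mem_insert, Finset.mem_biUnion, Finset.mem_union]
    exact .inr (.inr ⟨i, hi, .inr hb⟩)
  let e : V ≃ Fin V.card := V.equivFin
  let r (t : L.Term B) (h : t.varFinset ⊆ V) : L.Term (Empty ⊕ Fin V.card) :=
    t.restrictVar fun b => Sum.inr (e ⟨b, h b.2⟩)
  let Φ : List (L.BoundedFormula Empty V.card) := s.attach.toList.map fun i =>
    (r i.1.1 (hV₁ _ i.2)).bdEqual (r i.1.2 (hV₂ _ i.2))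
  let ψ : L.BoundedFormula Empty V.card :=
    (Term.var (Sum.inr (e ⟨p, hp⟩))).bdEqual (Term.var (Sum.inr (e ⟨q, hq⟩)))
  have hΦ : ∀ χ ∈ Φ, χ.IsAtomic := by
    intro χ hχ
    obtain ⟨i, -, rfl⟩ := List.mem_map.1 hχ
    exact .equal _ _
  have hmem : ((Φ.foldr (· ⊓ ·) ⊤).imp ψ).alls ∈ quasiTheory T := by
    refine ⟨⟨_, Φ, ψ, hΦ, .equal _ _, rfl⟩, Theory.models_sentence_iff.2 fun M => ?_⟩
    refine (realize_quasi _ _ _).2 fun xs hxs => ?_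
    -- the value of `v` outside `V` is irrelevant
    let v : B → M := fun b => if hb : b ∈ V then xs (e ⟨b, hb⟩) else xs (e ⟨p, hp⟩)
    have hv : ∀ b (hb : b ∈ V), v b = xs (e ⟨b, hb⟩) := fun b hb => dif_pos hb
    refine (BoundedFormula.realize_bdEqual _ _).2 ?_
    change xs _ = xs _
    rw [← hv p hp, ← hv q hq]
    by_contra hne
    obtain ⟨i, hi, hne'⟩ := hcon M v hne
    have := hxs _ (List.mem_map.2 ⟨⟨i, hi⟩, by simp, rfl⟩)
    rw [BoundedFormula.realize_bdEqual] at this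
    exact hne' ((realize_restrictVar_inr e hv (hV₁ i hi)).symm.trans
      (this.trans (realize_restrictVar_inr e hv (hV₂ i hi))))
  -- the quasi-algebraic consequence of `T` just found is violated in `B` by the elements of `V`
  refine hpq ?_
  have hid : ∀ b (hb : b ∈ V), id b = (fun j => (e.symm j : B)) (e ⟨b, hb⟩) := by simp
  have := (realize_quasi _ _ _).1 (hB.realize_of_mem _ hmem) (fun j => (e.symm j : B)) ?_
  · have := (BoundedFormula.realize_bdEqual _ _).1 this
    simpa using this
  · intro χ hχ
    obtain ⟨⟨i, hi⟩, -, rfl⟩ := List.mem_map.1 hχ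
    refine (BoundedFormula.realize_bdEqual _ _).2 ?_
    exact (realize_restrictVar_inr e hid (hV₁ i hi)).trans
      ((hs i hi).trans (realize_restrictVar_inr e hid (hV₂ i hi)).symm)

/-- Homomorphisms into models of `T` separate the points of a model of the quasi-algebraic
consequences of `T`.  By compactness, it suffices to find models in which `p ≠ q` together with
finitely many equations of the positive diagram of `B` hold. -/
theorem exists_hom_separating [L.IsAlgebraic] {T : L.Theory} {B : Type (max u w)}
    [L.Structure B] [B ⊨ quasiTheory T] {p q : B} (hpq : p ≠ q) :
    ∃ (M : Type (max u w)) (_ : L.Structure M) (_ : M ⊨ T) (g : B →[L] M), g p ≠ g q := by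
  let ι := {i : L.Term B × L.Term B // i.1.realize id = i.2.realize (id : B → B)}
  let D : ι → L[[B]].Theory := fun i => (L.lhomWithConstants B).onTheory T ∪
    {Formula.equivSentence ((Term.var p).equal (Term.var q)).not,
      Formula.equivSentence (i.1.1.equal i.1.2)}
  have hsat : Theory.IsSatisfiable (⋃ i, D i) := by
    classical
    refine (Theory.isSatisfiable_iUnion_iff_isSatisfiable_iUnion_finset D).2 fun s => ?_
    obtain ⟨M, v, hv, hs⟩ := exists_model_realizing_finite hpq (T := T) (s.image Subtype.val)
      (by
        intro i hi
        obtain ⟨j, -, rfl⟩ := Finset.mem_image.1 hi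
        exact j.2)
    let := constantsOn.structure v
    have : M ⊨ ⋃ i ∈ s, D i := by
      refine ⟨fun φ hφ => ?_⟩
      obtain ⟨i, hi, hφ⟩ := Set.mem_iUnion₂.1 hφ
      rcases hφ with hφ | rfl | rfl
      · exact ((LHom.onTheory_model _ T).2 M.is_model).realize_of_mem φ hφ
      · refine (Formula.realize_equivSentence M _).2 ?_
        rw [Formula.realize_not, Formula.realize_equal]
        exact hv
      · refine (Formula.realize_equivSentence M _).2 ?_
        rw [Formula.realize_equal]
        exact hs _ (Finset.mem_image_of_mem _ hi)
    exact Theory.Model.isSatisfiable M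
  obtain ⟨M⟩ := hsat
  let : L.Structure M := (L.lhomWithConstants B).reduct M
  have hM (i : ι) (φ : L[[B]].Sentence) (h : φ ∈ D i) : M ⊨ φ :=
    M.is_model.realize_of_mem φ (Set.mem_iUnion.2 ⟨i, h⟩)
  -- a trivial equation, used only as an index: `T` and `p ≠ q` belong to every `D i`
  let i₀ : ι := ⟨(Term.var p, Term.var p), rfl⟩
  -- the positive diagram of `B` makes the interpretation of the constants a homomorphism
  let v : B → M := fun b => (L.con b : M)
  refine ⟨M, inferInstance, ?_, ⟨v, fun {n} F x => ?_, fun r => isEmptyElim r⟩, ?_⟩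
  · exact (LHom.onTheory_model (L.lhomWithConstants B) T).1
      ⟨fun φ hφ => hM i₀ φ (.inl hφ)⟩
  · have := hM ⟨(Term.var (Structure.funMap F x), Term.func F fun j => Term.var (x j)), rfl⟩ _
      (.inr (.inr rfl))
    exact Formula.realize_equal.1 ((Formula.realize_equivSentence M _).1 this)
  · have := hM i₀ _ (.inr (.inl rfl))
    have := (Formula.realize_equivSentence M _).1 this
    rw [Formula.realize_not, Formula.realize_equal] at this
    exact this

/-- If `A` is geometrically closed, its quasi-algebraic sentences with parameters hold not only in
the models of `T` over `A`, but in all reduced `A`-algebras. -/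
theorem GeometricallyClosed.modelsQuasiDiagram [L.IsAlgebraic] {T : L.Theory} {A : Type w}
    [L.Structure A] (hG : GeometricallyClosed T A) {B : Type (max u w)} [L.Structure B]
    [B ⊨ quasiTheory T] (f : A →[L] B) : ModelsQuasiDiagram (L := L) f := by
  intro φ hφ hA
  obtain ⟨n, Φ, ψ, hΦ, hψ, rfl⟩ := id hφ
  refine (realize_quasi _ _ _).2 fun xs hxs => ?_
  cases hψ with
  | rel R _ => exact isEmptyElim R
  | equal t s =>
    rw [BoundedFormula.realize_bdEqual]
    by_contra hne
    obtain ⟨M, _, _, g, hg⟩ := exists_hom_separating (T := T) hne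
    have := (realize_quasi _ _ _).1 (hG M (g.comp f) _ hφ hA) (g ∘ xs)
      fun χ hχ => realize_isAtomic_of_hom g (hΦ χ hχ) (hxs χ hχ)
    rw [BoundedFormula.realize_bdEqual] at this
    refine hg ?_
    rw [← HomClass.realize_term g, ← HomClass.realize_term g, Sum.comp_elim]
    exact this

end Separation

/-! ### Kernels of homomorphisms of group-based algebras -/

section Kernel

variable {L : FirstOrder.Language.{u, 0}} {G : GroupSymbols L} {B C : Type*} [L.Structure B]
  [L.Structure C]

theorem map_op (g : B →[L] C) (x y : B) : g (G.op x y) = G.op (g x) (g y) :=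
  (g.map_fun G.mul _).trans (congrArg _ (funext fun i => by fin_cases i <;> rfl))

theorem map_inverse (g : B →[L] C) (x : B) : g (G.inverse x) = G.inverse (g x) :=
  (g.map_fun G.inv _).trans (congrArg _ (funext fun i => by fin_cases i; rfl))

theorem map_e (g : B →[L] C) : g (G.e B) = G.e C :=
  (g.map_fun G.one _).trans (congrArg _ (funext fun i => i.elim0))

theorem op_inverse_eq_e_iff (hC : G.IsGroupBased C) {x y : C} :
    G.op x (G.inverse y) = G.e C ↔ x = y :=
  letI := hC.toGroup
  mul_inv_eq_one

theorem isIdeal_kernel (hC : G.IsGroupBased C) (g : B →[L] C) :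
    G.IsIdeal {x | g x = G.e C} := by
  have hinv : G.inverse (G.e C) = G.e C := by
    rw [← hC.e_op (G.inverse _), hC.op_inverse]
  have hF {n : ℕ} (F : L.Functions n) (hn : 0 < n) {a : Fin n → B} (ha : ∀ i, g (a i) = G.e C) :
      g (Structure.funMap F a) = G.e C := by
    rw [g.map_fun, ← hC.map_e F hn]
    exact congrArg _ (funext ha)
  refine ⟨map_e g, fun {x y} hx hy => ?_, fun {x} hx => ?_, fun {x} y hx => ?_,
    fun {n} F hn a ha => hF F hn ha, fun {n} F hn a b ha => ?_⟩
  · simp only [Set.mem_ofPred_eq] at hx hy ⊢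
    rw [map_op, hx, hy, hC.e_op]
  · simp only [Set.mem_ofPred_eq] at hx ⊢
    rw [map_inverse, hx, hinv]
  · simp only [Set.mem_ofPred_eq] at hx ⊢
    rw [map_op, map_op, map_inverse, hx, hC.op_e, hC.op_inverse]
  · simp only [Set.mem_ofPred_eq] at ha ⊢
    have h : g (Structure.funMap F fun i => G.op (a i) (b i)) = g (Structure.funMap F b) := by
      rw [g.map_fun, g.map_fun]
      refine congrArg _ (funext fun i => ?_)
      simp only [Function.comp_apply]
      rw [map_op, ha, hC.e_op]
    rw [map_op, map_op, map_inverse, map_inverse, h, hF F hn ha, hinv, hC.e_op, hC.inverse_op]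

theorem op_inverse_mem_kernel_iff (hC : G.IsGroupBased C) (g : B →[L] C) {x y : B} :
    g (G.op x (G.inverse y)) = G.e C ↔ g x = g y := by
  rw [map_op, map_inverse, op_inverse_eq_e_iff hC]

/-- The kernel of a homomorphism onto a reduced algebra is a radical ideal: by the first isomorphism
theorem, the quotient is isomorphic to the target. -/
theorem isRadicalIdeal_kernel [L.IsAlgebraic] {T : L.Theory} (hB : G.IsGroupBased B)
    (hC : G.IsGroupBased C) [C ⊨ quasiTheory T] {g : B →[L] C} (hg : Function.Surjective g) :
    GroupSymbols.IsRadicalIdeal T hB (isIdeal_kernel hC g) := by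
  let := GroupSymbols.idealPrestructure hB (isIdeal_kernel hC g)
  let s := GroupSymbols.idealSetoid hB (isIdeal_kernel hC g)
  let f : Quotient s → C :=
    Quotient.lift g fun _ _ h => (op_inverse_mem_kernel_iff hC g).1 h
  have hf : Function.Bijective f := by
    refine ⟨fun x y h => ?_, fun c => ?_⟩
    · induction x using Quotient.inductionOn
      induction y using Quotient.inductionOn
      exact Quotient.sound ((op_inverse_mem_kernel_iff hC g).2 h)
    · obtain ⟨b, rfl⟩ := hg c
      exact ⟨Quotient.mk s b, rfl⟩
  have hfun {n : ℕ} (F : L.Functions n) (x : Fin n → Quotient s) :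
      f (Structure.funMap F x) = Structure.funMap F (f ∘ x) := by
    obtain ⟨y, rfl⟩ : ∃ y : Fin n → B, x = fun i => Quotient.mk s (y i) :=
      ⟨fun i => (x i).out, funext fun i => (Quotient.out_eq (x i)).symm⟩
    rw [funMap_quotient_mk' s F y]
    exact g.map_fun F y
  let E : Quotient s ≃[L] C :=
    { Equiv.ofBijective f hf with
      map_fun' := hfun
      map_rel' := fun r => isEmptyElim r }
  exact StrongHomClass.theory_model E.symm

end Kernel

/-! ### Evaluation of polynomials -/

/-- Every element of a finitely generated algebra is the value of a term at the generators. -/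
theorem exists_eval_eq {L : FirstOrder.Language.{u, 0}} {A : Type w} [L.Structure A] {B : Type*}
    [L.Structure B]    (f : A →[L] B) {n : ℕ} {b : Fin n → B}
    (hb : Substructure.closure L (Set.range f ∪ Set.range b) = ⊤) (x : B) :
    ∃ t : L.Term (A ⊕ Fin n), eval f b t = x := by
  have hx : x ∈ Substructure.closure L (Set.range f ∪ Set.range b) := hb ▸ Substructure.mem_top x
  obtain ⟨t, rfl⟩ := Substructure.mem_closure_iff_exists_term.1 hx
  have (y : ↥(Set.range f ∪ Set.range b)) : ∃ z : A ⊕ Fin n, Sum.elim f b z = y := by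
    obtain ⟨y, ⟨a, rfl⟩ | ⟨i, rfl⟩⟩ := y
    · exact ⟨.inl a, rfl⟩
    · exact ⟨.inr i, rfl⟩
  choose z hz using this
  refine ⟨t.relabel z, ?_⟩
  unfold eval
  rw [Term.realize_relabel]
  exact congrArg (fun v => t.realize v) (funext hz)

section Evaluation

variable {L : FirstOrder.Language.{u, 0}} [L.IsAlgebraic] {A : Type w} [L.Structure A]

/-- The evaluation homomorphism `A[X₁, …, Xₙ] → B` at a tuple `b` of an `A`-algebra `f : A → B` in
the variety generated by the models of `T`. -/
def polyEval (T : L.Theory) {B : Type (max u w)} [L.Structure B] [B ⊨ algTheory T] (f : A →[L] B)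
    {n : ℕ} (b : Fin n → B) : PolyAlg T A n →[L] B where
  toFun := Quotient.lift (eval f b) fun _ _ h => h B f b
  map_fun' F x := by
    obtain ⟨y, rfl⟩ : ∃ y : Fin _ → L.Term (A ⊕ Fin n), x = fun i => Quotient.mk _ (y i) :=
      ⟨fun i => (x i).out, funext fun i => (Quotient.out_eq (x i)).symm⟩
    rw [funMap_quotient_mk' (polySetoid T A n) F y]
    rfl
  map_rel' r := isEmptyElim r

theorem polyEval_mk (T : L.Theory) {B : Type (max u w)} [L.Structure B] [B ⊨ algTheory T]
    (f : A →[L] B) {n : ℕ} (b : Fin n → B) (t : L.Term (A ⊕ Fin n)) :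
    polyEval T f b (Quotient.mk _ t) = eval f b t := rfl

end Evaluation

/-! ### Full faithfulness of the coordinate algebra functor -/

section FullyFaithful

variable {L : FirstOrder.Language.{u, 0}} [L.IsAlgebraic] {A : Type w} [L.Structure A]

/-- A homomorphism of `A`-algebras `A[W] → A[V]` is the composition with a morphism `V → W`, whose
components are the images of the coordinate functions of `W`. -/
theorem exists_isMorphism_value {V W : AffVar L A}
    (g : CoordAlg L W.carrier →[L] CoordAlg L V.carrier)
    (hg : ∀ a, g (CoordAlg.ofBase L W.carrier a) = CoordAlg.ofBase L V.carrier a) :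
    ∃ f : V ⟶ W, ∀ a ha p, CoordAlg.value a ha (g p) =
      CoordAlg.value (f.1 ⟨a, ha⟩).1 (f.1 ⟨a, ha⟩).2 p := by
  obtain ⟨ts, hts⟩ := CoordAlg.exists_rep fun j => g (CoordAlg.coord L W.carrier j)
  have hmk (t : L.Term (A ⊕ Fin W.dim)) : g (Quotient.mk _ t) =
      eval (CoordAlg.ofBase L V.carrier) (fun j => g (CoordAlg.coord L W.carrier j)) t := by
    rw [CoordAlg.mk_eq_eval, eval, ← HomClass.realize_term g, Sum.comp_elim]
    congr 2
    exact funext hg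
  have hval (a) (ha : a ∈ V.carrier) (t : L.Term (A ⊕ Fin W.dim)) :
      CoordAlg.value a ha (g (Quotient.mk _ t)) = eval id (fun j => eval id a (ts j)) t := by
    rw [hmk, hts, eval]
    refine (HomClass.realize_term (CoordAlg.valueHom a ha)).symm.trans ?_
    rw [Sum.comp_elim]
    rfl
  have hmem (a) (ha : a ∈ V.carrier) : (fun j => eval id a (ts j)) ∈ W.carrier := by
    obtain ⟨π, hπ, hW⟩ := W.isAffine
    rw [hW]
    intro φ hφ
    cases hπ.2 φ hφ with
    | rel R _ => exact isEmptyElim R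
    | equal t s =>
      refine (BoundedFormula.realize_bdEqual _ _).2 ?_
      refine (hval a ha t).symm.trans (Eq.trans ?_ (hval a ha s))
      congr 2
      refine CoordAlg.mk_eq.2 fun c hc => ?_
      rw [hW] at hc
      exact (BoundedFormula.realize_bdEqual _ _).1 (hc _ hφ)
  refine ⟨⟨fun a => ⟨_, hmem a.1 a.2⟩, GivenBy.isMorphism (ts := ts) fun _ _ => rfl⟩, ?_⟩
  intro a ha p
  induction p using Quotient.inductionOn with
  | h t => exact hval a ha t

variable (T : L.Theory) [A ⊨ T] [Nonempty A]

theorem coordFunctor_faithful : (coordFunctor (A := A) T).Faithful where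
  map_injective {W V} f g h := by
    refine Quiver.Hom.unop_inj (Subtype.ext (funext fun a => Subtype.ext (funext fun j => ?_)))
    have := congrArg (fun k : ReducedAlg.Hom _ _ =>
      CoordAlg.value a.1 a.2 (k.toHom (CoordAlg.coord L W.unop.carrier j))) h
    exact (value_coordMap T f.unop a.1 a.2 _).symm.trans
      (this.trans (value_coordMap T g.unop a.1 a.2 _))

theorem coordFunctor_full : (coordFunctor (A := A) T).Full where
  map_surjective {W V} g := by
    obtain ⟨f, hf⟩ := exists_isMorphism_value (V := V.unop) (W := W.unop) g.toHom g.comp_hom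
    refine ⟨f.op, ReducedAlg.Hom.ext (Language.Hom.ext fun p => CoordAlg.ext_value fun a ha => ?_)⟩
    exact (value_coordMap T f a ha p).trans (hf a ha p).symm

end FullyFaithful

/-! ### Finitely generated reduced algebras are coordinate algebras -/

section EssSurj

variable {L : FirstOrder.Language.{u, 0}} [L.IsAlgebraic] {A : Type w} [L.Structure A]

/-- A bijective morphism of reduced `A`-algebras is an isomorphism. -/
noncomputable def ReducedAlg.isoOfBijective {T : L.Theory} {B C : ReducedAlg T A} (f : B ⟶ C)
    (hf : Function.Bijective (ReducedAlg.Hom.toHom f)) : B ≅ C :=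
  let E : B.carrier ≃[L] C.carrier := StrongHomClass.toEquiv
    { Equiv.ofBijective _ hf with
      map_fun' := fun F x => (ReducedAlg.Hom.toHom f).map_fun F x
      map_rel' := fun r => isEmptyElim r : B.carrier ≃[L] C.carrier }
  { hom := f
    inv := ⟨E.symm.toHom, fun a => E.injective (by
      refine (E.apply_symm_apply _).trans ?_
      exact (ReducedAlg.Hom.comp_hom f a).symm)⟩
    hom_inv_id := ReducedAlg.Hom.ext (Language.Hom.ext fun x => E.symm_apply_apply x)
    inv_hom_id := ReducedAlg.Hom.ext (Language.Hom.ext fun x => E.apply_symm_apply x) }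

/-- The relations between finitely many elements `b` of a reduced `A`-algebra are the equations that
hold on an affine variety.  Generators of the ideal of relations, which is radical, define the
variety; each equation valid on it follows in `A` from these generators, and this implication is
transferred to `B` since `A` is geometrically closed. -/
theorem exists_affVar_eval_eq_iff {G : GroupSymbols L} {T : L.Theory}
    (hT : G.IsGroupBasedTheory T) [A ⊨ T] [Nonempty A] (hN : RadicallyNoetherian hT A)
    (hG : GeometricallyClosed T A) {B : Type (max u w)} [L.Structure B] [B ⊨ quasiTheory T]
    (f : A →[L] B) {n : ℕ} {b : Fin n → B}
    (hb : Substructure.closure L (Set.range f ∪ Set.range b) = ⊤) :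
    ∃ V : Set (Fin n → A), (∃ π : Set (L.BoundedFormula A n), IsFiniteAType π ∧ V = zeros π) ∧
      ∀ t s : L.Term (A ⊕ Fin n),
        (∀ a ∈ V, eval id a t = eval id a s) ↔ eval f b t = eval f b s := by
  have : B ⊨ algTheory T := models_algTheory_of_models_quasiTheory
  have hB : G.IsGroupBased B := isGroupBased_of_algTheory hT
  have hsurj : Function.Surjective (polyEval T f b) := fun x => by
    obtain ⟨t, rfl⟩ := exists_eval_eq f hb x
    exact ⟨Quotient.mk _ t, rfl⟩
  obtain ⟨S, hSfin, hSI, hS⟩ := hN n _ (isIdeal_kernel hB (polyEval T f b))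
    (isRadicalIdeal_kernel _ hB hsurj)
  let π : Set (L.BoundedFormula A n) :=
    (fun p : PolyAlg T A n => (Quotient.out p).bdEqual (Term.func G.one ![])) '' S
  have hπ : IsFiniteAType π := by
    refine ⟨hSfin.image _, ?_⟩
    rintro φ ⟨p, -, rfl⟩
    exact .equal _ _
  have hsat {C : Type _} [L.Structure C] (v : A → C) (c : Fin n → C) :
      Sat π v c ↔ ∀ p ∈ S, eval v c (Quotient.out p) = G.e C := by
    have h (p : PolyAlg T A n) : BoundedFormula.Realize
        ((Quotient.out p).bdEqual (Term.func G.one ![])) v c ↔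
        eval v c (Quotient.out p) = G.e C := by
      rw [BoundedFormula.realize_bdEqual, realize_oneTerm]
    simp only [Sat, π, Set.forall_mem_image, h]
  refine ⟨zeros π, ⟨π, hπ, rfl⟩, fun t s => ⟨fun h => ?_, fun h => ?_⟩⟩
  · refine (BoundedFormula.realize_bdEqual _ _).1
      (modelsQuasiDiagram_sat (hG.modelsQuasiDiagram f) hπ (ψ := t.bdEqual s) (.equal _ _)
        (fun a ha => (BoundedFormula.realize_bdEqual _ _).2 (h a ha)) b ((hsat _ _).2 ?_))
    intro p hp
    rw [← polyEval_mk T, Quotient.out_eq]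
    exact hSI hp
  -- the kernel of `A[X] → A[V]` is an ideal containing `S`, hence all relations between the `b i`
  · have := coordAlg_reduced T (zeros π)
    have : CoordAlg L (zeros π) ⊨ algTheory T := models_algTheory_of_models_quasiTheory
    have hC : G.IsGroupBased (CoordAlg L (zeros π)) := isGroupBased_of_algTheory hT
    let k := polyEval T (CoordAlg.ofBase L (zeros π)) (CoordAlg.coord L (zeros π))
    have hk : {x | polyEval T f b x = G.e B} ⊆ {x | k x = G.e _} := by
      refine hS _ (isIdeal_kernel hC k) fun p hp => ?_
      have := (hsat (CoordAlg.ofBase L (zeros π)) (CoordAlg.coord L (zeros π))).1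
        ((sat_coordAlg hπ _).2 fun a ha => ha) p hp
      rw [← polyEval_mk T, Quotient.out_eq] at this
      exact this
    refine CoordAlg.mk_eq.1 ?_
    rw [CoordAlg.mk_eq_eval, CoordAlg.mk_eq_eval, ← polyEval_mk T, ← polyEval_mk T]
    exact (op_inverse_mem_kernel_iff hC k).1
      (hk ((op_inverse_mem_kernel_iff hB (polyEval T f b)).2 h))

theorem coordFunctorFin_essSurj {G : GroupSymbols L} {T : L.Theory}
    (hT : G.IsGroupBasedTheory T) [A ⊨ T] [Nonempty A] (hN : RadicallyNoetherian hT A)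
    (hG : GeometricallyClosed T A) : (coordFunctorFin T A).EssSurj where
  mem_essImage B := by
    obtain ⟨B, S, hS, hgen⟩ := B
    have := B.reduced
    obtain ⟨n, b, -, rfl⟩ := hS.fin_param
    obtain ⟨V, hV, hVB⟩ := exists_affVar_eval_eq_iff hT hN hG B.hom hgen
    let g : CoordAlg L V →[L] B.carrier :=
      { toFun := Quotient.lift (eval B.hom b)
          fun t s h => (hVB t s).1 (equal_mem_aType.1 h)
        map_fun' := fun F x => by
          obtain ⟨ts, rfl⟩ := CoordAlg.exists_rep x
          rw [CoordAlg.funMap_mk]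
          rfl
        map_rel' := fun r => isEmptyElim r }
    let V' : AffVar L A := ⟨n, V, hV⟩
    let g' : coordObj T V' ⟶ B := ReducedAlg.Hom.mk g fun _ => rfl
    have hg : Function.Bijective g := by
      refine ⟨fun x y h => ?_, fun x => ?_⟩
      · induction x using Quotient.inductionOn
        induction y using Quotient.inductionOn
        exact CoordAlg.mk_eq.2 ((hVB _ _).2 h)
      · obtain ⟨t, rfl⟩ := exists_eval_eq B.hom hgen x
        exact ⟨Quotient.mk _ t, rfl⟩
    exact ⟨Opposite.op V', ⟨(isFinGen T A).isoMk (ReducedAlg.isoOfBijective g' hg)⟩⟩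

end EssSurj

end GeomAlg

theorem mainTheorem12 (L : FirstOrder.Language.{u, 0}) [L.IsAlgebraic]
    (G : GeomAlg.GroupSymbols L) (T : L.Theory) (hT : G.IsGroupBasedTheory T)
    (A : Type w) [L.Structure A] [Nonempty A] [A ⊨ T]
    (hN : GeomAlg.RadicallyNoetherian hT A) (hG : GeomAlg.GeometricallyClosed T A) :
    (GeomAlg.coordFunctorFin T A).IsEquivalence where
  faithful :=
    have := GeomAlg.coordFunctor_faithful (A := A) T
    CategoryTheory.Functor.Faithful.of_comp_iso (G := (GeomAlg.isFinGen T A).ι)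
      (CategoryTheory.Iso.refl (GeomAlg.coordFunctor T))
  full :=
    have := GeomAlg.coordFunctor_full (A := A) T
    CategoryTheory.Functor.Full.of_comp_faithful_iso (G := (GeomAlg.isFinGen T A).ι)
      (CategoryTheory.Iso.refl (GeomAlg.coordFunctor T))
  essSurj := GeomAlg.coordFunctorFin_essSurj hT hN hG
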